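/- Let $F$ be a finite field of characteristic $p$ and order $q=p^n$, and let $\psi(x)=e^{2\pi i\,\mathrm{Tr}(x)/p}$ be the canonical additive character of $F$, where $\mathrm{Tr}\colon F\to\mathbb{F}_p$ is the absolute trace. For a positive integer $d$ and $a\in F$ let $$W_{F,d}(a)=\sum_{x\in F}\psi(x^d-ax),$$ which lies in $\mathbb{Q}(e^{2\pi i/p})$. Let $\mathrm{val}_p$ be the extension of the $p$-adic valuation from $\mathbb{Q}$ to $\mathbb{Q}(e^{2\pi i/p})$, so that $\mathrm{val}_p(1-e^{2\pi i/p})=1/(p-1)$ and $\mathrm{val}_p(0)=\infty$, and put $$V_{F,d}=\min_{a\in F}\mathrm{val}_p(W_{F,d}(a)).$$ Suppose that $p\equiv 1\pmod 3$ and $d=(2q+1)/3$ (which is then a positive integer). Then: 1. $d\equiv 1\pmod{p-1}$ if and only if $3\mid n$. 2. $\gcd(d,q-1)=1$ if and only if $q\equiv 1$ or $7\pmod 9$. 3. If $\gcd(d,q-1)=1$, then $V_{F,d}=n/3$. -/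

import Mathlib

open scoped NumberField

noncomputable section

namespace WeilSum

/-- `ζ_p = e^{2πi/p}`. -/
def zeta (p : ℕ) : ℂ := Complex.exp (2 * Real.pi * Complex.I / p)

/-- The field `ℚ(e^{2πi/p})`, as a subfield of `ℂ`. -/
abbrev CycField (p : ℕ) : IntermediateField ℚ ℂ := IntermediateField.adjoin ℚ {zeta p}

/-- `ζ_p` as an element of `ℚ(ζ_p)`. -/
def zetaK (p : ℕ) : CycField p :=
  ⟨zeta p, IntermediateField.subset_adjoin ℚ {zeta p} rfl⟩

theorem zeta_isPrimitiveRoot (p : ℕ) [Fact p.Prime] : IsPrimitiveRoot (zeta p) p :=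
  Complex.isPrimitiveRoot_exp p (Fact.out : p.Prime).ne_zero

theorem zetaK_isPrimitiveRoot (p : ℕ) [Fact p.Prime] : IsPrimitiveRoot (zetaK p) p :=
  IsPrimitiveRoot.coe_submonoidClass_iff.mp (zeta_isPrimitiveRoot p)

instance instCyc (p : ℕ) [Fact p.Prime] : IsCyclotomicExtension {p} ℚ (CycField p) := by
  have hi : IsIntegral ℚ (zeta p) :=
    ((zeta_isPrimitiveRoot p).isIntegral (Fact.out : p.Prime).pos).tower_top
  change IsCyclotomicExtension {p} ℚ (IntermediateField.adjoin ℚ {zeta p}).toSubalgebra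
  rw [IntermediateField.adjoin_simple_toSubalgebra_of_isAlgebraic hi.isAlgebraic]
  exact (zeta_isPrimitiveRoot p).adjoin_isCyclotomicExtension ℚ

instance instNumberField (p : ℕ) [Fact p.Prime] : NumberField (CycField p) :=
  IsCyclotomicExtension.numberField {p} ℚ (CycField p)

/-- The prime ideal `(ζ_p - 1)` of the ring of integers of `ℚ(ζ_p)`. -/
def primeAbove (p : ℕ) [Fact p.Prime] : IsDedekindDomain.HeightOneSpectrum (𝓞 (CycField p)) where
  asIdeal := Ideal.span {(zetaK_isPrimitiveRoot p).toInteger - 1}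
  isPrime := (Ideal.span_singleton_prime
    (zetaK_isPrimitiveRoot p).zeta_sub_one_prime'.ne_zero).mpr
      (zetaK_isPrimitiveRoot p).zeta_sub_one_prime'
  ne_bot := by
    simpa [Ideal.span_singleton_eq_bot] using
      (zetaK_isPrimitiveRoot p).zeta_sub_one_prime'.ne_zero

/-- The `p`-adic valuation on `ℚ(ζ_p)`, with values in `ℚ ∪ {∞}`: the valuation attached to the
prime ideal `(ζ_p - 1)`, divided by `p - 1`. -/
def val (p : ℕ) [Fact p.Prime] (x : CycField p) : WithTop ℚ :=
  if x = 0 then ⊤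
  else (((-WithZero.log ((primeAbove p).valuation (CycField p) x) : ℤ) : ℚ) / ((p : ℚ) - 1) : ℚ)

theorem log_valuation_zeta (p : ℕ) [Fact p.Prime] :
    WithZero.log ((primeAbove p).valuation (CycField p) (1 - zetaK p)) = -1 := by
  have h0 := (zetaK_isPrimitiveRoot p).zeta_sub_one_prime'.ne_zero
  have h1 : (1 - zetaK p) = - algebraMap (𝓞 (CycField p)) (CycField p)
      ((zetaK_isPrimitiveRoot p).toInteger - 1) := by
    rw [map_sub, map_one, neg_sub]
    rfl
  rw [h1, Valuation.map_neg, IsDedekindDomain.HeightOneSpectrum.valuation_of_algebraMap,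
    (primeAbove p).intValuation_singleton h0 rfl]
  simp

/-- `val_p (1 - ζ_p) = 1 / (p - 1)`. -/
theorem val_one_sub_zeta (p : ℕ) [Fact p.Prime] :
    val p (1 - zetaK p) = ((1 / ((p : ℚ) - 1) : ℚ) : WithTop ℚ) := by
  have h : (1 - zetaK p) ≠ 0 := by
    intro h
    exact (zetaK_isPrimitiveRoot p).ne_one (Fact.out : p.Prime).one_lt (sub_eq_zero.mp h).symm
  rw [val, if_neg h, log_valuation_zeta]
  simp

theorem val_mul (p : ℕ) [Fact p.Prime] (x y : CycField p) :
    val p (x * y) = val p x + val p y := by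
  by_cases hx : x = 0
  · simp [val, hx]
  by_cases hy : y = 0
  · simp [val, hy]
  rw [val, val, val, if_neg hx, if_neg hy, if_neg (mul_ne_zero hx hy), map_mul,
    WithZero.log_mul (by simpa using hx) (by simpa using hy), ← WithTop.coe_add]
  congr 1
  push_cast
  ring

theorem le_val_add (p : ℕ) [Fact p.Prime] (x y : CycField p) :
    min (val p x) (val p y) ≤ val p (x + y) := by
  by_cases hx : x = 0
  · simp [val, hx]
  by_cases hy : y = 0
  · simp [val, hy]
  by_cases hxy : x + y = 0
  · simp [val, hxy]
  have hp : (0 : ℚ) < (p : ℚ) - 1 := by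
    have := (Fact.out : p.Prime).one_lt
    have : (1 : ℚ) < p := by exact_mod_cast this
    linarith
  rw [val, val, val, if_neg hx, if_neg hy, if_neg hxy]
  rcases ((primeAbove p).valuation (CycField p)).map_add' x y with h | h
  · refine (min_le_left _ _).trans (WithTop.coe_le_coe.mpr ?_)
    have := (WithZero.log_le_log (by simpa using hxy) (by simpa using hx)).mpr h
    gcongr
  · refine (min_le_right _ _).trans (WithTop.coe_le_coe.mpr ?_)
    have := (WithZero.log_le_log (by simpa using hxy) (by simpa using hy)).mpr h
    gcongr

theorem valuation_eq_one (p : ℕ) [Fact p.Prime] (m : ℕ) (hm : ¬ p ∣ m) :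
    (primeAbove p).valuation (CycField p) (m : CycField p) = 1 := by
  have : IsCyclotomicExtension {p ^ (0 + 1)} ℚ (CycField p) := by
    simpa using instCyc p
  have hz : IsPrimitiveRoot (zetaK p) (p ^ (0 + 1)) := by
    simpa using zetaK_isPrimitiveRoot p
  have h := IsCyclotomicExtension.Rat.zeta_sub_one_dvd_intCast_iff p 0 hz (n := (m : ℤ))
  have h2 : (m : CycField p) = algebraMap (𝓞 (CycField p)) (CycField p) (m : 𝓞 (CycField p)) := by
    simp
  rw [h2, IsDedekindDomain.HeightOneSpectrum.valuation_eq_one_iff_notMem]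
  intro hmem
  apply hm
  have h3 : (zetaK_isPrimitiveRoot p).toInteger - 1 ∣ (m : 𝓞 (CycField p)) :=
    Ideal.mem_span_singleton.mp hmem
  exact_mod_cast h.mp (by exact_mod_cast h3)

theorem log_valuation_p (p : ℕ) [Fact p.Prime] :
    WithZero.log ((primeAbove p).valuation (CycField p) (p : CycField p)) = -((p : ℤ) - 1) := by
  have : IsCyclotomicExtension {p ^ (0 + 1)} ℚ (CycField p) := by
    simpa using instCyc p
  have hz : IsPrimitiveRoot (zetaK p) (p ^ (0 + 1)) := by
    simpa using zetaK_isPrimitiveRoot p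
  have h := IsCyclotomicExtension.Rat.map_eq_span_zeta_sub_one_pow p 0 hz
  have hf : Module.finrank ℚ (CycField p) = p - 1 := by
    rw [IsCyclotomicExtension.finrank (n := p) (CycField p)
      (Polynomial.cyclotomic.irreducible_rat (Fact.out : p.Prime).pos),
      Nat.totient_prime Fact.out]
  rw [hf, Ideal.map_span, Set.image_singleton, Ideal.span_singleton_pow,
    Ideal.span_singleton_eq_span_singleton] at h
  obtain ⟨u, hu⟩ := h
  have hu' : ((p : ℕ) : 𝓞 (CycField p)) * u =
      ((zetaK_isPrimitiveRoot p).toInteger - 1) ^ (p - 1) := by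
    simpa using hu
  have hv := congrArg (primeAbove p).intValuation hu'
  have hu1 : (primeAbove p).intValuation (u : 𝓞 (CycField p)) = 1 := by
    rw [IsDedekindDomain.HeightOneSpectrum.intValuation_eq_one_iff]
    exact fun hmem => (primeAbove p).isPrime.ne_top (Ideal.eq_top_of_isUnit_mem _ hmem u.isUnit)
  rw [map_mul, hu1, mul_one, map_pow, (primeAbove p).intValuation_singleton
    (zetaK_isPrimitiveRoot p).zeta_sub_one_prime'.ne_zero rfl] at hv
  have h2 : (p : CycField p) = algebraMap (𝓞 (CycField p)) (CycField p) (p : 𝓞 (CycField p)) := by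
    simp
  rw [h2, IsDedekindDomain.HeightOneSpectrum.valuation_of_algebraMap, hv, WithZero.log_pow,
    WithZero.log_exp]
  have := (Fact.out : p.Prime).one_lt
  rw [nsmul_eq_mul, Nat.cast_sub this.le]
  push_cast
  ring

theorem log_valuation_nat (p : ℕ) [Fact p.Prime] (m : ℕ) (hm : m ≠ 0) :
    WithZero.log ((primeAbove p).valuation (CycField p) (m : CycField p)) =
      -(padicValNat p m * ((p : ℤ) - 1)) := by
  have hp : p ≠ 1 := (Fact.out : p.Prime).ne_one
  obtain ⟨k, l, hl, rfl⟩ := Nat.exists_eq_pow_mul_and_not_dvd hm p hp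
  have hl0 : l ≠ 0 := by rintro rfl; exact hl (dvd_zero p)
  have hp0 : p ≠ 0 := (Fact.out : p.Prime).ne_zero
  rw [padicValNat.mul (pow_ne_zero _ hp0) hl0, padicValNat.prime_pow,
    padicValNat.eq_zero_of_not_dvd hl, Nat.cast_mul, Nat.cast_pow, map_mul, map_pow,
    valuation_eq_one p l hl, mul_one, WithZero.log_pow, log_valuation_p,
    nsmul_eq_mul]
  push_cast
  ring

/-- `val_p` restricts to the usual `p`-adic valuation on `ℚ`. -/
theorem val_ratCast (p : ℕ) [Fact p.Prime] (r : ℚ) (hr : r ≠ 0) :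
    val p (r : CycField p) = ((padicValRat p r : ℚ) : WithTop ℚ) := by
  have hd : (r.den : CycField p) ≠ 0 := by exact_mod_cast r.den_ne_zero
  have hn : (r.num : CycField p) ≠ 0 := by exact_mod_cast Rat.num_ne_zero.mpr hr
  have hr' : (r : CycField p) ≠ 0 := by exact_mod_cast hr
  have hp : (p : ℚ) - 1 ≠ 0 := by
    have := (Fact.out : p.Prime).one_lt
    have : (1 : ℚ) < p := by exact_mod_cast this
    linarith
  have hnum : (primeAbove p).valuation (CycField p) (r.num : CycField p) =
      (primeAbove p).valuation (CycField p) (r.num.natAbs : CycField p) := by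
    rcases Int.natAbs_eq r.num with h | h
    · conv_lhs => rw [h]
      simp
    · conv_lhs => rw [h]
      rw [Int.cast_neg, Valuation.map_neg, Int.cast_natCast]
  rw [val, if_neg hr']
  congr 1
  rw [Rat.cast_def, map_div₀, WithZero.log_div (by simpa using hn) (by simp), hnum,
    log_valuation_nat p _ (by simpa using hr), log_valuation_nat p _ r.den_ne_zero, padicValRat,
    padicValInt]
  push_cast
  field_simp
  ring

/-- The canonical additive character `ψ(x) = e^{2πi Tr(x)/p}` of a finite field of
characteristic `p`, where `Tr` is the absolute trace. -/
def psi (p : ℕ) [Fact p.Prime] {F : Type*} [Field F] [Algebra (ZMod p) F] (x : F) : ℂ :=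
  Complex.exp (2 * Real.pi * Complex.I * (Algebra.trace (ZMod p) F x).val / p)

/-- The Weil sum `W_{F,d}(a) = ∑_{x ∈ F} ψ(x^d - a x)`. -/
def weilSum (p : ℕ) [Fact p.Prime] (F : Type*) [Field F] [Fintype F] [Algebra (ZMod p) F]
    (d : ℕ) (a : F) : ℂ :=
  ∑ x : F, psi p (x ^ d - a * x)

theorem weilSum_mem (p : ℕ) [Fact p.Prime] (F : Type*) [Field F] [Fintype F]
    [Algebra (ZMod p) F] (d : ℕ) (a : F) : weilSum p F d a ∈ CycField p := by
  refine sum_mem fun x _ => ?_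
  have h : psi p (x ^ d - a * x) =
      zeta p ^ (Algebra.trace (ZMod p) F (x ^ d - a * x)).val := by
    rw [psi, zeta, ← Complex.exp_nat_mul]
    congr 1
    ring
  rw [h]
  exact pow_mem (IntermediateField.subset_adjoin ℚ {zeta p} rfl) _

/-- `V_{F,d} = min_{a ∈ F} val_p (W_{F,d}(a))`. -/
def V (p : ℕ) [Fact p.Prime] (F : Type*) [Field F] [Fintype F] [Algebra (ZMod p) F]
    (d : ℕ) : WithTop ℚ :=
  Finset.univ.inf' Finset.univ_nonempty
    fun a : F => val p ⟨weilSum p F d a, weilSum_mem p F d a⟩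

end WeilSum

end

/-!
Write `q = 3m + 1`, so that `d = 2m + 1` and `x ^ d = x (x ^ m) ^ 2`: on each of the three cosets
of the cubes in `Fˣ`, the power map is multiplication by a cube root of unity of `F`.
Detecting the cosets with a cubic character `χ` writes three times the Weil sum at `a` as
`q N + G(χ) A(a) + G(χ²) B(a)`, where `N`, `A(a)`, `B(a)` are algebraic integers and `G` denotes
Gauss sums (`three_mul_sum_addChar`).

For a character `η` of order three `G(η)³ = q J(η, η)`, with `J` the Jacobi sum, so in the ring of
all algebraic integers both Gauss sums are divisible by a cube root `c` of `q`. Hence so is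
`3 W(a)`, and every Weil sum has valuation at least `n/3`.

For equality, reduce to characteristic `p` the quotients `3 W(a) / c`
(`exists_cube_eq_card_mul`). With `χ` chosen to lift `x ↦ x ^ m`, the Jacobi sums become power sums
over `F` of `(x (1 - x)) ^ m` and `(x (1 - x)) ^ (2m)`. The first is `0`; the second is, up to
sign, the binomial coefficient `(2m choose m)`, which is prime to `p` because doubling
`m = (p ^ n - 1) / 3` in base `p` has no carry. So only `B(a) G(χ²) / c` survives, and `B(a)`
reduces to a nonzero polynomial in `a` of degree less than `q`, which cannot vanish on all of `F`.
If every Weil sum had valuation larger than `n/3`, the cubes of all these quotients would lie in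
the prime `(ζ_p - 1)` and reduce to `0` (`le_val_of_cube_eq`). This uses neither Stickelberger's
theorem nor an explicit extension of the valuation.
-/

namespace WeilSum

/-! ### Cubic characters and the Weil sum -/

section CubicCharacter

variable {F : Type*} [Field F] {R : Type*} [CommRing R] [IsDomain R]

theorem one_add_add_sq_of_isPrimitiveRoot {z : R} (hz : IsPrimitiveRoot z 3) :
    1 + z + z ^ 2 = 0 := by
  simpa [Finset.sum_range_succ] using hz.geom_sum_eq_zero (by norm_num)

/-- `x ^ (2m+1) = x · (x ^ m) ^ 2` is `ω ^ (2j) x` on the coset `x ^ m = ω ^ j` of the cubes, and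
the character `χ` selects this coset. -/
theorem three_mul_addChar {m : ℕ} {ω : F} (hω : IsPrimitiveRoot ω 3) {ζ : R}
    (hζ : IsPrimitiveRoot ζ 3) {χ : MulChar F R}
    (h : ∀ x : F, x ≠ 0 → ∃ j, x ^ m = ω ^ j ∧ χ x = ζ ^ j) (ψ : AddChar F R) (a x : F) :
    3 * ψ (x ^ (2 * m + 1) - a * x) = ∑ i ∈ Finset.range 3,
      (1 + ζ ^ (2 * i) * χ x + ζ ^ i * (χ ^ 2) x) * ψ ((ω ^ (2 * i) - a) * x) := by
  by_cases hx : x = 0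
  · subst hx
    simp [MulChar.map_zero]
  obtain ⟨j, hj, hχ⟩ := h x hx
  have hω3 : ω ^ 3 = 1 := hω.pow_eq_one
  have hζ3 : ζ ^ 3 = 1 := hζ.pow_eq_one
  have hs := one_add_add_sq_of_isPrimitiveRoot hζ
  have hxd : x ^ (2 * m + 1) = (ω ^ j) ^ 2 * x := by rw [pow_succ, mul_comm 2 m, pow_mul, hj]
  rw [pow_eq_pow_mod j hω3] at hxd
  rw [pow_eq_pow_mod j hζ3] at hχ
  rw [hxd, ← sub_mul, MulChar.pow_apply' _ two_ne_zero, hχ]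
  have hω4 : ω ^ 4 = ω := by rw [pow_succ, hω3, one_mul]
  have hj3 : j % 3 < 3 := Nat.mod_lt _ (by norm_num)
  generalize j % 3 = r at *
  have hζ4 : ζ ^ 4 = ζ := by rw [pow_succ, hζ3, one_mul]
  interval_cases r
  · simp only [Finset.sum_range_succ, Finset.sum_range_zero]
    norm_num [hω4, hζ4]
    linear_combination (-ψ ((ω ^ 2 - a) * x) - ψ ((ω - a) * x)) * hs
  · simp only [Finset.sum_range_succ, Finset.sum_range_zero]
    norm_num [hω4, hζ4]
    linear_combination (-ψ ((1 - a) * x) - ψ ((ω - a) * x)) * hs -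
      (2 * ψ ((ω ^ 2 - a) * x) + ζ * ψ ((ω - a) * x)) * hζ3
  · simp only [Finset.sum_range_succ, Finset.sum_range_zero]
    norm_num [hω4, hζ4, ← pow_mul]
    linear_combination (-ψ ((1 - a) * x) - ψ ((ω ^ 2 - a) * x)) * hs -
      (ζ * ψ ((ω ^ 2 - a) * x) + 2 * ψ ((ω - a) * x)) * hζ3

variable [Fintype F]

/-- This includes `b = 0`, where both sides vanish. -/
theorem sum_mulChar_mul_addChar {χ : MulChar F R} (hχ : χ ≠ 1) (ψ : AddChar F R) (b : F) :
    ∑ x, χ x * ψ (b * x) = χ⁻¹ b * gaussSum χ ψ := by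
  by_cases hb : b = 0
  · simp [hb, MulChar.sum_eq_zero_of_ne_one hχ, MulChar.map_zero]
  · exact gaussSum_mulShift_eq χ ψ (Units.mk0 b hb)

/-- Three times the Weil sum is a combination of the two cubic Gauss sums, up to multiples of the
cardinality of the field. -/
theorem three_mul_sum_addChar {m : ℕ} {ω : F} (hω : IsPrimitiveRoot ω 3) {ζ : R}
    (hζ : IsPrimitiveRoot ζ 3) {χ : MulChar F R}
    (h : ∀ x : F, x ≠ 0 → ∃ j, x ^ m = ω ^ j ∧ χ x = ζ ^ j) (hχ : orderOf χ = 3)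
    {ψ : AddChar F R} (hψ : ψ.IsPrimitive) (a : F) :
    ∃ N : R, 3 * ∑ x, ψ (x ^ (2 * m + 1) - a * x) = Fintype.card F * N +
      gaussSum χ ψ * ∑ i ∈ Finset.range 3, ζ ^ (2 * i) * χ⁻¹ (ω ^ (2 * i) - a) +
      gaussSum (χ ^ 2) ψ * ∑ i ∈ Finset.range 3, ζ ^ i * χ (ω ^ (2 * i) - a) := by
  classical
  have h3 : χ ^ 3 = 1 := hχ ▸ pow_orderOf_eq_one χ
  have h1 : χ ≠ 1 := by
    rintro rfl
    simp at hχ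
  have h2 : χ ^ 2 ≠ 1 := by
    intro h2
    have := orderOf_dvd_of_pow_eq_one h2
    rw [hχ] at this
    omega
  have hinv : (χ ^ 2)⁻¹ = χ := by
    rw [inv_eq_iff_mul_eq_one, ← pow_succ, h3]
  refine ⟨∑ i ∈ Finset.range 3, if ω ^ (2 * i) - a = 0 then 1 else 0, ?_⟩
  rw [Finset.mul_sum, Finset.sum_congr rfl fun x _ => three_mul_addChar hω hζ h ψ a x,
    Finset.sum_comm, Finset.mul_sum, Finset.mul_sum, Finset.mul_sum, ← Finset.sum_add_distrib,
    ← Finset.sum_add_distrib]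
  refine Finset.sum_congr rfl fun i _ => ?_
  have e1 := sum_mulChar_mul_addChar h1 ψ (ω ^ (2 * i) - a)
  have e2 := sum_mulChar_mul_addChar h2 ψ (ω ^ (2 * i) - a)
  have e0 := AddChar.sum_mulShift (ω ^ (2 * i) - a) hψ
  rw [hinv] at e2
  simp_rw [mul_comm _ (ω ^ (2 * i) - a)] at e0
  have e0' : ((if ω ^ (2 * i) - a = 0 then Fintype.card F else 0 : ℕ) : R) =
      Fintype.card F * if ω ^ (2 * i) - a = 0 then 1 else 0 := by
    split_ifs <;> simp
  rw [e0'] at e0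
  rw [← e0, mul_left_comm, mul_comm (gaussSum χ ψ), ← e1, mul_left_comm,
    mul_comm (gaussSum (χ ^ 2) ψ), ← e2, Finset.mul_sum, Finset.mul_sum,
    ← Finset.sum_add_distrib, ← Finset.sum_add_distrib]
  exact Finset.sum_congr rfl fun x _ => by ring

theorem gaussSum_pow_three {χ : MulChar F R} (hχ : orderOf χ = 3) {ψ : AddChar F R}
    (hψ : ψ.IsPrimitive) :
    gaussSum χ ψ ^ 3 = Fintype.card F * jacobiSum χ χ := by
  have h := gaussSum_pow_eq_prod_jacobiSum (χ := χ) (by rw [hχ]; norm_num) hψ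
  have h3 : χ ^ 3 = 1 := hχ ▸ pow_orderOf_eq_one χ
  have h1 : χ (-1) = 1 := by
    have : χ (-1) = (χ ^ 3) (-1) := by
      rw [MulChar.pow_apply' _ three_ne_zero, ← map_pow]
      norm_num
    rw [this, h3]
    exact MulChar.one_apply isUnit_one.neg
  rw [hχ, h1] at h
  simpa using h

end CubicCharacter

/-! ### Power sums and the reduction of cubic Jacobi sums -/

section Reduction

variable {F : Type*} [Field F] [Fintype F]

theorem exists_pow_eq_three_mul_add_one (p : ℕ) (hp : p % 3 = 1) (n : ℕ) :
    ∃ m, p ^ n = 3 * m + 1 := by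
  have : p ^ n % 3 = 1 := by rw [Nat.pow_mod, hp]; simp
  exact ⟨p ^ n / 3, by omega⟩

/-- The base `p` digits of `(p ^ n - 1) / 3` all equal `(p - 1) / 3`, so doubling it produces no
carry. -/
theorem not_dvd_centralBinom {p : ℕ} [Fact p.Prime] (hp : p % 3 = 1) (n m : ℕ)
    (h : p ^ n = 3 * m + 1) : ¬ p ∣ (2 * m).choose m := by
  have hpp : p.Prime := Fact.out
  induction n generalizing m with
  | zero =>
    obtain rfl : m = 0 := by simp at h; omega
    simpa using hpp.one_lt.ne'
  | succ n ih =>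
    obtain ⟨r, hr⟩ := exists_pow_eq_three_mul_add_one p hp n
    obtain ⟨s, rfl⟩ : ∃ s, p = 3 * s + 1 := ⟨p / 3, by omega⟩
    obtain rfl : m = s + (3 * s + 1) * r := by rw [pow_succ, hr] at h; nlinarith
    have hL := Choose.choose_modEq_choose_mod_mul_choose_div_nat
      (n := 2 * (s + (3 * s + 1) * r)) (k := s + (3 * s + 1) * r) (p := 3 * s + 1)
    have e : 2 * (s + (3 * s + 1) * r) = 2 * s + (3 * s + 1) * (2 * r) := by ring
    rw [e, Nat.add_mul_mod_self_left, Nat.add_mul_mod_self_left,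
      Nat.add_mul_div_left _ _ hpp.pos, Nat.add_mul_div_left _ _ hpp.pos,
      Nat.mod_eq_of_lt (by omega), Nat.mod_eq_of_lt (by omega), Nat.div_eq_of_lt (by omega),
      Nat.div_eq_of_lt (by omega), zero_add, zero_add] at hL
    rw [e, (hL.dvd_iff dvd_rfl), hpp.dvd_mul, not_or]
    refine ⟨fun hd => ?_, ih r hr⟩
    -- `(2s choose s)` divides `(2s)!`, and `2s < p`.
    have hf := Nat.choose_mul_factorial_mul_factorial (by omega : s ≤ 2 * s)
    rw [mul_assoc] at hf
    have := hpp.dvd_factorial.mp (hd.trans (Dvd.intro _ hf))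
    omega

theorem sum_pow_eq_neg_one : ∑ x : F, x ^ (Fintype.card F - 1) = -1 := by
  classical
  have h : ∀ x : F, x ^ (Fintype.card F - 1) = 1 - if x = 0 then 1 else 0 := by
    intro x
    split_ifs with hx
    · have := Fintype.one_lt_card (α := F)
      simp [hx, show Fintype.card F - 1 ≠ 0 by omega]
    · simp [FiniteField.pow_card_sub_one_eq_one x hx]
  simp [h]

theorem sum_pow_eq_zero_of_lt {i : ℕ} (h1 : Fintype.card F - 1 < i)
    (h2 : i < 2 * (Fintype.card F - 1)) : ∑ x : F, x ^ i = 0 := by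
  rw [← FiniteField.sum_pow_lt_card_sub_one F (i - (Fintype.card F - 1)) (by omega)]
  refine Finset.sum_congr rfl fun x _ => ?_
  by_cases hx : x = 0
  · rw [hx, zero_pow (by omega), zero_pow (by omega)]
  · conv_lhs => rw [show i = i - (Fintype.card F - 1) + (Fintype.card F - 1) by omega]
    rw [pow_add, FiniteField.pow_card_sub_one_eq_one x hx, mul_one]

theorem mul_one_sub_pow {F : Type*} [CommRing F] (x : F) (N : ℕ) : (x * (1 - x)) ^ N =
    ∑ j ∈ Finset.range (N + 1), (-1) ^ j * (N.choose j : F) * x ^ (N + j) := by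
  rw [mul_pow, sub_eq_neg_add, add_pow, Finset.mul_sum]
  refine Finset.sum_congr rfl fun j _ => ?_
  rw [one_pow, neg_pow, pow_add]
  ring

theorem sum_mul_one_sub_pow_eq_zero {m : ℕ} (hm : m ≠ 0) (hF : Fintype.card F = 3 * m + 1) :
    ∑ x : F, (x * (1 - x)) ^ m = 0 := by
  simp_rw [mul_one_sub_pow]
  rw [Finset.sum_comm]
  refine Finset.sum_eq_zero fun j hj => ?_
  rw [Finset.mem_range] at hj
  rw [← Finset.mul_sum, FiniteField.sum_pow_lt_card_sub_one F _ (by omega), mul_zero]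

/-- Only the monomial `x ^ (3m) = x ^ (q-1)` of `(x (1 - x)) ^ (2m)` contributes. -/
theorem sum_mul_one_sub_pow_two_mul {m : ℕ} (hF : Fintype.card F = 3 * m + 1) :
    ∑ x : F, (x * (1 - x)) ^ (2 * m) = -((-1) ^ m * ((2 * m).choose m : F)) := by
  simp_rw [mul_one_sub_pow]
  rw [Finset.sum_comm, Finset.sum_eq_single_of_mem m (by simp; omega)]
  · rw [← Finset.mul_sum, show 2 * m + m = Fintype.card F - 1 by omega, sum_pow_eq_neg_one]
    ring
  · intro j hj hjm
    rw [Finset.mem_range] at hj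
    rw [← Finset.mul_sum]
    rcases lt_or_gt_of_ne hjm with h | h
    · rw [FiniteField.sum_pow_lt_card_sub_one F _ (by omega), mul_zero]
    · rw [sum_pow_eq_zero_of_lt (by omega) (by omega), mul_zero]

/-- Seen as a polynomial in `a` of degree less than the cardinality of `F`, the sum has nonzero
coefficient `± 3m` at `a ^ (m-1)`. -/
theorem exists_sum_ne_zero {m : ℕ} (hm : m ≠ 0) (hF : Fintype.card F = 3 * m + 1) {ω : F}
    (hω : ω ^ 3 = 1) :
    ∃ a : F, ∑ i ∈ Finset.range 3, ω ^ i * (ω ^ (2 * i) - a) ^ m ≠ 0 := by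
  by_contra! hall
  open Polynomial in
  let P : F[X] := ∑ i ∈ Finset.range 3, C (ω ^ i) * (C (ω ^ (2 * i)) - X) ^ m
  have hP : P = 0 := by
    refine Polynomial.eq_zero_of_natDegree_lt_card_of_eval_eq_zero' P Finset.univ ?_ ?_
    · intro a _
      simpa [P, Polynomial.eval_finsetSum] using hall a
    · rw [Finset.card_univ, hF]
      refine lt_of_le_of_lt (b := m) ?_ (by omega)
      refine Polynomial.natDegree_sum_le_of_forall_le _ _ fun i _ => ?_
      compute_degree
  have hc : P.coeff (m - 1) = (-1) ^ (m - 1) * (3 * m : F) := by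
    have key : ∀ c : F, ((Polynomial.C c - Polynomial.X) ^ m).coeff (m - 1) =
        (-1) ^ (m - 1) * c * m := by
      intro c
      obtain ⟨l, rfl⟩ := Nat.exists_eq_succ_of_ne_zero hm
      have : (Polynomial.C c - Polynomial.X) ^ (l + 1) =
          Polynomial.C ((-1) ^ (l + 1)) * (Polynomial.X + Polynomial.C (-c)) ^ (l + 1) := by
        rw [Polynomial.C_pow, ← mul_pow]
        congr 1
        simp [sub_eq_add_neg]
      rw [Nat.succ_eq_add_one, this, Polynomial.coeff_C_mul, Polynomial.coeff_X_add_C_pow]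
      simp
      ring
    have hP' : P.coeff (m - 1) =
        ∑ i ∈ Finset.range 3, ω ^ i * ((-1) ^ (m - 1) * ω ^ (2 * i) * m) := by
      simp only [P, Polynomial.finsetSum_coeff, Polynomial.coeff_C_mul, key]
    rw [hP']
    simp only [Finset.sum_range_succ, Finset.sum_range_zero]
    linear_combination (-1) ^ (m - 1) * m * (2 + ω ^ 3) * hω
  have h3 : (3 * m : F) = -1 := by
    have := FiniteField.cast_card_eq_zero F
    rw [hF] at this
    push_cast at this
    linear_combination this
  rw [hP, h3] at hc
  simp at hc

variable {R : Type*} [CommRing R] {k : Type*} [Field k]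

theorem map_jacobiSum (red : R →+* k) (ι : F →+* k) {χ : MulChar F R} {N : ℕ}
    (h : ∀ x, red (χ x) = ι x ^ N) : red (jacobiSum χ χ) = ι (∑ x : F, (x * (1 - x)) ^ N) := by
  simp [jacobiSum, h, mul_pow]

end Reduction

/-! ### Dividing the Weil sum by the cube root of the cardinality -/

section Core

variable {F : Type*} [Field F] [Fintype F] {R : Type*} [CommRing R] [IsDomain R]
  {k : Type*} [Field k]

/-- The cubic character of `F` with values in `R` which lifts `x ↦ x ^ ((q-1)/3)` along `red`. -/
theorem exists_cubic_mulChar {m : ℕ} (hm : m ≠ 0) (hF : Fintype.card F = 3 * m + 1)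
    (ι : F →+* k) (red : R →+* k) {z : R} (hz : IsPrimitiveRoot z 3) :
    ∃ (ω : F) (ζ : R) (χ : MulChar F R), IsPrimitiveRoot ω 3 ∧ IsPrimitiveRoot ζ 3 ∧
      orderOf χ = 3 ∧ (∀ x : F, x ≠ 0 → ∃ j, x ^ m = ω ^ j ∧ χ x = ζ ^ j) ∧ ι ω = red ζ := by
  classical
  obtain ⟨g, hg⟩ := IsCyclic.exists_generator (α := Fˣ)
  have hcard : Fintype.card Fˣ = 3 * m := by rw [Fintype.card_units, hF]; omega
  have hog : orderOf g = 3 * m := by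
    rw [orderOf_eq_card_of_forall_mem_zpowers hg, Nat.card_eq_fintype_card, hcard]
  have hω : IsPrimitiveRoot ((g : F) ^ m) 3 := by
    have h := IsPrimitiveRoot.orderOf g
    rw [hog] at h
    exact (IsPrimitiveRoot.coe_units_iff.mpr h).pow (by omega) (by ring)
  obtain ⟨ζ, hζ, hred⟩ : ∃ ζ : R, IsPrimitiveRoot ζ 3 ∧ ι ((g : F) ^ m) = red ζ := by
    have e1 := congrArg ι (one_add_add_sq_of_isPrimitiveRoot hω)
    have e2 := congrArg red (one_add_add_sq_of_isPrimitiveRoot hz)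
    have e3 := congrArg red hz.pow_eq_one
    simp only [map_add, map_one, map_zero, map_pow] at e1 e2 e3 ⊢
    -- `ι (g ^ m)` is a root of `X ^ 2 + X + 1`, which splits over the image of `red`.
    have : (ι (g : F) ^ m - red z) * (ι (g : F) ^ m - red z ^ 2) = 0 := by
      linear_combination e1 - ι (g : F) ^ m * e2 + e3
    rcases mul_eq_zero.mp this with h | h
    · exact ⟨z, hz, sub_eq_zero.mp h⟩
    · exact ⟨z ^ 2, hz.pow_of_coprime 2 (by norm_num), by rw [sub_eq_zero.mp h, map_pow]⟩
  have hζu : (hζ.isUnit (by norm_num)).unit ∈ rootsOfUnity (Fintype.card Fˣ) R := by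
    rw [mem_rootsOfUnity', hcard, IsUnit.unit_spec, pow_mul, hζ.pow_eq_one, one_pow]
  let χ : MulChar F R := MulChar.ofRootOfUnity hζu hg
  have hχg : χ g = ζ := MulChar.ofRootOfUnity_spec hζu hg
  have hval : ∀ x : F, x ≠ 0 → ∃ j, x ^ m = ((g : F) ^ m) ^ j ∧ χ x = ζ ^ j := by
    intro x hx
    obtain ⟨j, hj⟩ := (mem_powers_iff_mem_zpowers (x := g)).mpr (hg (Units.mk0 x hx))
    have hj' : x = (g : F) ^ j := by
      rw [← Units.val_pow_eq_pow_val]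
      exact congrArg Units.val hj.symm
    exact ⟨j, by rw [hj', ← pow_mul, ← pow_mul, mul_comm], by rw [hj', map_pow, hχg]⟩
  refine ⟨(g : F) ^ m, ζ, χ, hω, hζ, ?_, hval, hred⟩
  refine orderOf_eq_prime ?_ fun h => hζ.ne_one (by norm_num) ?_
  · ext u
    obtain ⟨j, -, hj⟩ := hval u u.ne_zero
    rw [MulChar.pow_apply' _ three_ne_zero, hj, ← pow_mul, mul_comm, pow_mul, hζ.pow_eq_one,
      one_pow, MulChar.one_apply_coe]
  · rw [← hχg, h, MulChar.one_apply_coe]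

/-- Let `c` be a cube root of `q`. Since the cubes of the Gauss sums are `q` times Jacobi sums,
the Gauss sums are divisible by `c`, and so is three times each Weil sum. After reduction to
characteristic `p`, only the Gauss sum whose Jacobi sum is a unit survives in the quotient. -/
theorem exists_cube_eq_card_mul {p n : ℕ} [Fact p.Prime] (hp : p % 3 = 1) [CharP k p] {m : ℕ}
    (hF : Fintype.card F = 3 * m + 1) (hn : Fintype.card F = p ^ n) (ι : F →+* k)
    (red : R →+* k) {z : R} (hz : IsPrimitiveRoot z 3) {c : R} (hc : c ^ 3 = Fintype.card F)
    (hc0 : c ≠ 0) (hdvd : ∀ a b : R, a ^ 3 ∣ b ^ 3 → a ∣ b) {ψ : AddChar F R}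
    (hψ : ψ.IsPrimitive) :
    ∃ U : F → R, (∀ a, (3 * ∑ x, ψ (x ^ (2 * m + 1) - a * x)) ^ 3 = Fintype.card F * U a) ∧
      ∃ a, red (U a) ≠ 0 := by
  have hm : m ≠ 0 := by
    rintro rfl
    have := Fintype.one_lt_card (α := F)
    omega
  obtain ⟨ω, ζ, χ, hω, hζ, hχ, hval, hred⟩ := exists_cubic_mulChar hm hF ι red hz
  have hχ2 : orderOf (χ ^ 2) = 3 := by
    rw [orderOf_pow, hχ]
    norm_num
  have hredχ : ∀ x, red (χ x) = ι x ^ m := by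
    intro x
    by_cases hx : x = 0
    · simp [hx, hm, MulChar.map_zero]
    · obtain ⟨j, hj, hj'⟩ := hval x hx
      rw [hj', ← map_pow, hj, map_pow, map_pow, hred]
  have hredχ2 : ∀ x, red ((χ ^ 2) x) = ι x ^ (2 * m) := by
    intro x
    rw [MulChar.pow_apply' _ two_ne_zero, map_pow, hredχ, ← pow_mul, mul_comm]
  have key : ∀ {η : MulChar F R}, orderOf η = 3 → ∃ y, gaussSum η ψ = c * y ∧
      y ^ 3 = jacobiSum η η := by
    intro η hη
    have h := gaussSum_pow_three hη hψ
    rw [← hc] at h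
    obtain ⟨y, hy⟩ := hdvd c (gaussSum η ψ) ⟨_, h⟩
    exact ⟨y, hy, mul_left_cancel₀ (pow_ne_zero 3 hc0) (by rw [← mul_pow, ← hy, h])⟩
  obtain ⟨y₁, hy₁, hJ₁⟩ := key hχ
  obtain ⟨y₂, hy₂, hJ₂⟩ := key hχ2
  have hz₁ : red y₁ = 0 := by
    have := congrArg red hJ₁
    rw [map_jacobiSum red ι hredχ, sum_mul_one_sub_pow_eq_zero hm hF, map_zero, map_pow] at this
    exact pow_eq_zero_iff three_ne_zero |>.mp this
  have hz₂ : red y₂ ≠ 0 := by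
    intro h
    have := congrArg red hJ₂
    rw [map_jacobiSum red ι hredχ2, sum_mul_one_sub_pow_two_mul hF, map_pow, h, map_neg, map_mul,
      map_natCast, zero_pow three_ne_zero, zero_eq_neg, mul_eq_zero, map_pow, map_neg, map_one,
      CharP.cast_eq_zero_iff k p] at this
    rcases this with h | h
    · exact pow_ne_zero m (neg_ne_zero.mpr one_ne_zero) h
    · exact not_dvd_centralBinom hp n m (hn ▸ hF) h
  have hzc : red c = 0 := by
    have := congrArg red hc
    rw [hn, map_pow, map_natCast, Nat.cast_pow, CharP.cast_eq_zero, zero_pow] at this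
    · exact pow_eq_zero_iff three_ne_zero |>.mp this
    · rintro rfl
      have := Fintype.one_lt_card (α := F)
      simp at hn
      omega
  choose N hN using three_mul_sum_addChar hω hζ hval hχ hψ
  refine ⟨fun a => (c ^ 2 * N a +
      y₁ * ∑ i ∈ Finset.range 3, ζ ^ (2 * i) * χ⁻¹ (ω ^ (2 * i) - a) +
      y₂ * ∑ i ∈ Finset.range 3, ζ ^ i * χ (ω ^ (2 * i) - a)) ^ 3, fun a => ?_, ?_⟩
  · rw [hN, ← hc, hy₁, hy₂]
    ring
  · obtain ⟨a, ha⟩ := exists_sum_ne_zero hm hF hω.pow_eq_one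
    refine ⟨a, ?_⟩
    have hB : red (∑ i ∈ Finset.range 3, ζ ^ i * χ (ω ^ (2 * i) - a)) ≠ 0 := by
      have : red (∑ i ∈ Finset.range 3, ζ ^ i * χ (ω ^ (2 * i) - a)) =
          ι (∑ i ∈ Finset.range 3, ω ^ i * (ω ^ (2 * i) - a) ^ m) := by
        simp [hredχ, ← hred]
      rw [this]
      exact (map_ne_zero ι).mpr ha
    rw [map_pow, map_add, map_add, map_mul, map_mul, map_mul, map_pow, hzc, hz₁,
      zero_pow two_ne_zero, zero_mul, zero_mul, zero_add, zero_add]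
    exact pow_ne_zero 3 (mul_ne_zero hz₂ hB)

end Core

/-! ### The `p`-adic valuation and algebraic integers -/

section Valuation

variable {p : ℕ} [Fact p.Prime]

theorem cast_prime_sub_one_pos : (0 : ℚ) < (p : ℚ) - 1 :=
  sub_pos.mpr (by exact_mod_cast (Fact.out : p.Prime).one_lt)

theorem val_nonneg (z : 𝓞 (CycField p)) : 0 ≤ val p z := by
  by_cases hz : (z : CycField p) = 0
  · simp [val, hz]
  · rw [val, if_neg hz, ← WithTop.coe_zero, WithTop.coe_le_coe]
    refine div_nonneg ?_ cast_prime_sub_one_pos.le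
    have h := (WithZero.log_le_log (by simpa using hz) one_ne_zero).mpr
      ((primeAbove p).valuation_le_one (K := CycField p) z)
    rw [WithZero.log_one] at h
    exact_mod_cast neg_nonneg.mpr h

theorem mem_primeAbove_of_val_pos {z : 𝓞 (CycField p)} (h : 0 < val p z) :
    z ∈ (primeAbove p).asIdeal := by
  by_cases hz : (z : CycField p) = 0
  · rw [(map_eq_zero_iff _ (FaithfulSMul.algebraMap_injective (𝓞 (CycField p)) _)).mp hz]
    exact zero_mem _
  · rw [val, if_neg hz, ← WithTop.coe_zero, WithTop.coe_lt_coe,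
      div_pos_iff_of_pos_right cast_prime_sub_one_pos] at h
    rw [← (primeAbove p).valuation_lt_one_iff_mem (K := CycField p)]
    by_contra! hle
    have := (WithZero.log_le_log one_ne_zero (by simpa using hz)).mpr hle
    rw [WithZero.log_one] at this
    exact (Int.cast_pos.mp h).not_ge (neg_nonpos.mpr this)

/-- Every ring homomorphism to characteristic `p` sends `ζ_p` to `1`, hence kills the prime ideal
`(ζ_p - 1)`. -/
theorem map_eq_zero_of_mem_primeAbove {k : Type*} [Field k] [CharP k p]
    (f : 𝓞 (CycField p) →+* k) {z : 𝓞 (CycField p)} (hz : z ∈ (primeAbove p).asIdeal) :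
    f z = 0 := by
  obtain ⟨y, rfl⟩ := Ideal.mem_span_singleton.mp hz
  have h : f (zetaK_isPrimitiveRoot p).toInteger ^ p = 1 := by
    rw [← map_pow, (zetaK_isPrimitiveRoot p).toInteger_isPrimitiveRoot.pow_eq_one, map_one]
  have h1 : f (zetaK_isPrimitiveRoot p).toInteger = 1 := by
    have : (f (zetaK_isPrimitiveRoot p).toInteger - 1) ^ p = 0 := by
      rw [sub_pow_char, h, one_pow, sub_self]
    exact sub_eq_zero.mp (pow_eq_zero_iff (Fact.out : p.Prime).ne_zero |>.mp this)
  rw [map_mul, map_sub, h1, map_one, sub_self, zero_mul]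

theorem exists_ringOfIntegers_map_eq {p : ℕ} {x : CycField p} {u : 𝓞 ℂ}
    (h : (x : ℂ) = algebraMap (𝓞 ℂ) ℂ u) :
    ∃ z : 𝓞 (CycField p), (z : CycField p) = x ∧
      NumberField.RingOfIntegers.mapRingHom (algebraMap (CycField p) ℂ) z = u := by
  have hx : IsIntegral ℤ x := by
    have hu : IsIntegral ℤ (algebraMap (CycField p) ℂ x) := by
      rw [show algebraMap (CycField p) ℂ x = algebraMap (𝓞 ℂ) ℂ u from h]
      exact u.isIntegral_coe
    exact (isIntegral_algebraMap_iff (algebraMap (CycField p) ℂ).injective).mp hu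
  exact ⟨⟨x, hx⟩, rfl, NumberField.RingOfIntegers.ext h⟩

/-- If `(3w)³ = p ^ n u` with `u` an algebraic integer, then `val w ≥ n/3`, and the inequality is
strict only if `u` lies in all primes above `p`. -/
theorem le_val_of_cube_eq (h3 : p ≠ 3) {n : ℕ} {w : CycField p} {u : 𝓞 ℂ}
    (h : (3 * (w : ℂ)) ^ 3 = p ^ n * algebraMap (𝓞 ℂ) ℂ u) :
    (((n : ℚ) / 3 : ℚ) : WithTop ℚ) ≤ val p w ∧
    ((((n : ℚ) / 3 : ℚ) : WithTop ℚ) < val p w → ∀ {k : Type} [Field k] [CharP k p]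
      (red : 𝓞 ℂ →+* k), red u = 0) := by
  have hpp : p.Prime := Fact.out
  have hp0 : (p : CycField p) ^ n ≠ 0 := pow_ne_zero _ (by exact_mod_cast hpp.ne_zero)
  obtain ⟨z, hz, hzu⟩ := exists_ringOfIntegers_map_eq (p := p)
    (x := (3 * w) ^ 3 / (p : CycField p) ^ n) (u := u) (by
      have : (p : ℂ) ^ n ≠ 0 := pow_ne_zero _ (by exact_mod_cast hpp.ne_zero)
      rw [eq_comm, ← mul_right_inj' this, ← h]
      have h3 : ((3 : CycField p) : ℂ) = 3 := rfl
      push_cast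
      rw [h3]
      field_simp)
  have hE : 27 * (w * (w * w)) = (p : CycField p) ^ n * z := by
    rw [hz]
    field_simp
    ring
  have v27 : val p (27 : CycField p) = 0 := by
    have := val_ratCast p 27 (by norm_num)
    have h27 : padicValRat p 27 = 0 := by
      rw [show (27 : ℚ) = ((27 : ℕ) : ℚ) by norm_num, padicValRat.of_nat,
        padicValNat.eq_zero_of_not_dvd, Nat.cast_zero]
      intro hd
      rw [show 27 = 3 ^ 3 by norm_num] at hd
      exact h3 ((Nat.prime_dvd_prime_iff_eq hpp Nat.prime_three).mp (hpp.dvd_of_dvd_pow hd))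
    rw [h27] at this
    simpa using this
  have vp : val p ((p : CycField p) ^ n) = ((n : ℚ) : WithTop ℚ) := by
    have := val_ratCast p ((p : ℚ) ^ n) (pow_ne_zero _ (by exact_mod_cast hpp.ne_zero))
    rw [padicValRat.pow, padicValRat.self hpp.one_lt] at this
    simpa using this
  have hv := congrArg (val p) hE
  rw [val_mul, val_mul, val_mul, val_mul, v27, vp, zero_add] at hv
  have hnn := val_nonneg z
  have hpos : (((n : ℚ) / 3 : ℚ) : WithTop ℚ) < val p w → 0 < val p z := by
    intro hlt
    cases hzv : val p (z : CycField p) with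
    | top => exact WithTop.coe_lt_top 0
    | coe s =>
      cases hwv : val p w with
      | top => exact absurd (hzv ▸ hwv ▸ hv).symm WithTop.coe_ne_top
      | coe r =>
        rw [hzv, hwv] at hv
        rw [hwv] at hlt
        norm_cast at hv hlt ⊢
        linarith
  refine ⟨?_, fun hlt k _ _ red => ?_⟩
  · cases hwv : val p w with
    | top => exact le_top
    | coe r =>
      cases hzv : val p (z : CycField p) with
      | top => exact absurd (hzv ▸ hwv ▸ hv) WithTop.coe_ne_top
      | coe s =>
        rw [hzv, hwv] at hv
        rw [hzv] at hnn
        norm_cast at hv hnn ⊢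
        linarith
  · rw [← hzu]
    exact map_eq_zero_of_mem_primeAbove
      (red.comp (NumberField.RingOfIntegers.mapRingHom (algebraMap (CycField p) ℂ)))
      (mem_primeAbove_of_val_pos (hpos hlt))

end Valuation

section ComplexIntegers

theorem exists_algebraMap_eq {x : ℂ} (h : IsIntegral ℤ x) : ∃ u : 𝓞 ℂ, algebraMap (𝓞 ℂ) ℂ u = x :=
  ⟨⟨x, h⟩, rfl⟩

theorem dvd_of_pow_three_dvd (a b : 𝓞 ℂ) (h : a ^ 3 ∣ b ^ 3) : a ∣ b := by
  obtain ⟨e, he⟩ := h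
  by_cases ha : a = 0
  · rw [ha, zero_pow three_ne_zero, zero_mul, pow_eq_zero_iff three_ne_zero] at he
    rw [he]
    exact dvd_zero a
  have ha' := NumberField.RingOfIntegers.coe_ne_zero_iff.mpr ha
  have he' := congrArg (algebraMap (𝓞 ℂ) ℂ) he
  rw [map_mul, map_pow, map_pow] at he'
  obtain ⟨t, ht⟩ := exists_algebraMap_eq
    (x := algebraMap (𝓞 ℂ) ℂ b / algebraMap (𝓞 ℂ) ℂ a) <| by
      refine IsIntegral.of_pow (n := 3) (by norm_num) ?_
      rw [div_pow, he', mul_div_cancel_left₀ _ (pow_ne_zero 3 ha')]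
      exact e.isIntegral_coe
  refine ⟨t, NumberField.RingOfIntegers.coe_injective ?_⟩
  rw [map_mul, ht, mul_div_cancel₀ _ ha']

/-- The common target of the two homomorphisms is an algebraic closure of the residue field at a
maximal ideal containing `p`. -/
theorem exists_ringHom_charP (p : ℕ) [Fact p.Prime] (F : Type*) [Field F] [Finite F]
    [Algebra (ZMod p) F] :
    ∃ (k : Type) (_ : Field k) (_ : CharP k p), Nonempty (𝓞 ℂ →+* k) ∧ Nonempty (F →+* k) := by
  have hpp : p.Prime := Fact.out
  have hne : Ideal.span {(p : 𝓞 ℂ)} ≠ ⊤ := by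
    rw [Ne, Ideal.span_singleton_eq_top]
    intro hu
    obtain ⟨e, he⟩ := hu.exists_right_inv
    have he' : (p : ℂ) * algebraMap (𝓞 ℂ) ℂ e = 1 := by
      have := congrArg (algebraMap (𝓞 ℂ) ℂ) he
      simpa using this
    have hp0 : (p : ℂ) ≠ 0 := by exact_mod_cast hpp.ne_zero
    -- Otherwise `1 / p` would be a rational algebraic integer.
    have hi : IsIntegral ℤ ((p : ℚ)⁻¹) := by
      refine (isIntegral_algebraMap_iff (algebraMap ℚ ℂ).injective).mp ?_
      have : algebraMap ℚ ℂ ((p : ℚ)⁻¹) = algebraMap (𝓞 ℂ) ℂ e := by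
        rw [map_inv₀, map_natCast]
        exact inv_eq_of_mul_eq_one_right he'
      rw [this]
      exact e.isIntegral_coe
    obtain ⟨y, hy⟩ := IsIntegrallyClosed.isIntegral_iff.mp hi
    have hyp : (y : ℚ) * p = 1 := by
      rw [show (y : ℚ) = (p : ℚ)⁻¹ from hy, inv_mul_cancel₀ (by exact_mod_cast hpp.ne_zero)]
    have hyp' : y * (p : ℤ) = 1 := by exact_mod_cast hyp
    have := Int.isUnit_iff_natAbs_eq.mp (IsUnit.of_mul_eq_one_right y hyp')
    exact hpp.ne_one (by simpa using this)
  obtain ⟨M, hM, hle⟩ := Ideal.exists_le_maximal _ hne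
  let _ : Field (𝓞 ℂ ⧸ M) := Ideal.Quotient.field M
  let red : 𝓞 ℂ →+* AlgebraicClosure (𝓞 ℂ ⧸ M) :=
    (algebraMap (𝓞 ℂ ⧸ M) (AlgebraicClosure (𝓞 ℂ ⧸ M))).comp (Ideal.Quotient.mk M)
  have hchar : CharP (AlgebraicClosure (𝓞 ℂ ⧸ M)) p := by
    refine (CharP.charP_iff_prime_eq_zero hpp).mpr ?_
    rw [← map_natCast red, RingHom.comp_apply, Ideal.Quotient.eq_zero_iff_mem.mpr, map_zero]
    exact hle (Ideal.mem_span_singleton_self _)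
  let _ : Algebra (ZMod p) (AlgebraicClosure (𝓞 ℂ ⧸ M)) := ZMod.algebra _ p
  exact ⟨_, inferInstance, hchar, ⟨red⟩, ⟨(IsAlgClosed.lift (R := ZMod p) (S := F)).toRingHom⟩⟩

theorem exists_addChar_coe_eq_psi (p : ℕ) [Fact p.Prime] (F : Type*) [Field F] [Finite F]
    [Algebra (ZMod p) F] :
    ∃ ψ : AddChar F (𝓞 ℂ), ψ.IsPrimitive ∧ ∀ x, algebraMap (𝓞 ℂ) ℂ (ψ x) = psi p x := by
  have hpp : p.Prime := Fact.out
  obtain ⟨ζ, hζp⟩ := exists_algebraMap_eq ((zeta_isPrimitiveRoot p).isIntegral hpp.pos)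
  have hζ : ζ ^ p = 1 := NumberField.RingOfIntegers.coe_injective <| by
    rw [map_pow, map_one, hζp, (zeta_isPrimitiveRoot p).pow_eq_one]
  refine ⟨(AddChar.zmodChar p hζ).compAddMonoidHom (Algebra.trace (ZMod p) F).toAddMonoidHom,
    AddChar.IsPrimitive.of_ne_one ?_, fun x => ?_⟩
  · rw [AddChar.ne_one_iff]
    obtain ⟨x, hx⟩ := Algebra.trace_surjective (ZMod p) F 1
    refine ⟨x, fun h => ?_⟩
    rw [AddChar.compAddMonoidHom_apply] at h
    have h1 : (AddChar.zmodChar p hζ) 1 = 1 := by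
      rw [← hx]
      exact h
    rw [AddChar.zmodChar_apply, ZMod.val_one, pow_one] at h1
    exact (zeta_isPrimitiveRoot p).ne_one hpp.one_lt (by rw [← hζp, h1, map_one])
  · rw [AddChar.compAddMonoidHom_apply, AddChar.zmodChar_apply, map_pow, hζp, psi, zeta,
      ← Complex.exp_nat_mul]
    congr 1
    simp only [LinearMap.toAddMonoidHom_coe]
    ring

end ComplexIntegers

/-- All Weil sums for `d = (2q+1)/3` have valuation at least `n/3`, and one attains this bound. -/
theorem V_eq_div_three {p : ℕ} [Fact p.Prime] (hp : p % 3 = 1) (F : Type*) [Field F] [Fintype F]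
    [Algebra (ZMod p) F] {n m : ℕ} (hF : Fintype.card F = 3 * m + 1)
    (hn : Fintype.card F = p ^ n) :
    V p F (2 * m + 1) = (((n : ℚ) / 3 : ℚ) : WithTop ℚ) := by
  obtain ⟨k, _, _, ⟨red⟩, ⟨ι⟩⟩ := exists_ringHom_charP p F
  obtain ⟨ψ, hψ, hψp⟩ := exists_addChar_coe_eq_psi p F
  obtain ⟨c₀, hc₀⟩ := IsAlgClosed.exists_pow_nat_eq (Fintype.card F : ℂ) (n := 3) (by norm_num)
  obtain ⟨c, rfl⟩ := exists_algebraMap_eq (IsIntegral.of_pow (x := c₀) (n := 3) (by norm_num) (by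
    rw [hc₀]
    exact isIntegral_natCast _))
  have hc : c ^ 3 = Fintype.card F := NumberField.RingOfIntegers.coe_injective <| by
    rw [map_pow, hc₀, map_natCast]
  have hc0 : c ≠ 0 := by
    rintro rfl
    rw [zero_pow three_ne_zero] at hc
    exact Fintype.card_ne_zero (α := F) (by exact_mod_cast hc.symm)
  have hz₀ := Complex.isPrimitiveRoot_exp 3 three_ne_zero
  obtain ⟨z, hz⟩ := exists_algebraMap_eq (hz₀.isIntegral (by norm_num))
  rw [← hz] at hz₀
  have hz3 : IsPrimitiveRoot z 3 :=
    hz₀.of_map_of_injective NumberField.RingOfIntegers.coe_injective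
  obtain ⟨U, hU, a, ha⟩ := exists_cube_eq_card_mul hp hF hn ι red hz3 hc hc0
    dvd_of_pow_three_dvd hψ
  have hW : ∀ a, (3 * weilSum p F (2 * m + 1) a) ^ 3 = (p : ℂ) ^ n * algebraMap (𝓞 ℂ) ℂ (U a) := by
    intro a
    have := congrArg (algebraMap (𝓞 ℂ) ℂ) (hU a)
    rw [hn, map_mul, map_pow, map_mul, map_sum, map_ofNat, map_natCast, Nat.cast_pow] at this
    simpa only [weilSum, hψp] using this
  have h3 : p ≠ 3 := by omega
  have hval := fun a => le_val_of_cube_eq h3 (w := ⟨_, weilSum_mem p F (2 * m + 1) a⟩) (hW a)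
  rw [V]
  refine le_antisymm ?_ (Finset.le_inf' _ _ fun a _ => (hval a).1)
  by_contra! hlt
  exact ha ((hval a).2 (hlt.trans_le (Finset.inf'_le _ (Finset.mem_univ a))) red)

/-! ### Arithmetic of the exponent -/

/-- With `S = 1 + p + ⋯ + p ^ (n-1) ≡ n` modulo `3`, the condition `p - 1 ∣ 2m` becomes
`3 (p - 1) ∣ 2 S (p - 1)`. -/
theorem modEq_one_iff_three_dvd {p n m : ℕ} (hp : p % 3 = 1) (hp1 : 1 < p)
    (h : p ^ n = 3 * m + 1) : 2 * m + 1 ≡ 1 [MOD p - 1] ↔ 3 ∣ n := by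
  set S := ∑ i ∈ Finset.range n, p ^ i with hS
  have hgeom : S * (p - 1) = 3 * m := by
    rw [hS, geom_sum_mul_of_one_le hp1.le, h, Nat.add_sub_cancel]
  have hS3 : S ≡ n [MOD 3] := by
    have : S ≡ ∑ i ∈ Finset.range n, 1 [MOD 3] :=
      Nat.ModEq.sum fun i _ => by
        have : p ≡ 1 [MOD 3] := hp
        simpa using this.pow i
    simpa using this
  have h1 : 2 * m + 1 ≡ 1 [MOD p - 1] ↔ (p - 1) ∣ 2 * m := by
    rw [Nat.ModEq.comm, Nat.modEq_iff_dvd' (by omega)]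
    simp
  have hpos : 0 < p - 1 := by omega
  rw [h1, ← Nat.mul_dvd_mul_iff_left (a := 3) (by norm_num),
    show 3 * (2 * m) = 2 * S * (p - 1) by rw [mul_assoc, hgeom]; ring,
    Nat.mul_dvd_mul_iff_right hpos, ← (hS3.dvd_iff dvd_rfl)]
  omega

theorem gcd_eq_one_iff_mod_nine (m : ℕ) :
    Nat.gcd (2 * m + 1) (3 * m) = 1 ↔ (3 * m + 1) % 9 = 1 ∨ (3 * m + 1) % 9 = 7 := by
  have h1 : Nat.Coprime (2 * m + 1) m := by
    rw [Nat.coprime_mul_right_add_left]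
    exact Nat.coprime_one_left m
  rw [← Nat.coprime_iff_gcd_eq_one, Nat.coprime_mul_iff_right, and_iff_left h1, Nat.coprime_comm,
    Nat.prime_three.coprime_iff_not_dvd]
  omega

end WeilSum

theorem lemma5p7 (p : ℕ) [Fact p.Prime] (hp : p ≡ 1 [MOD 3])
    (F : Type*) [Field F] [Fintype F] [Algebra (ZMod p) F]
    (q n d : ℕ) (hq : q = Fintype.card F) (hn : q = p ^ n) (hd : 3 * d = 2 * q + 1) :
    (d ≡ 1 [MOD p - 1] ↔ 3 ∣ n) ∧
    (Nat.gcd d (q - 1) = 1 ↔ q % 9 = 1 ∨ q % 9 = 7) ∧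
    (Nat.gcd d (q - 1) = 1 → WeilSum.V p F d = (((n : ℚ) / 3 : ℚ) : WithTop ℚ)) := by
  have hp3 : p % 3 = 1 := hp
  obtain ⟨m, hm⟩ := WeilSum.exists_pow_eq_three_mul_add_one p hp3 n
  obtain rfl : q = 3 * m + 1 := hn.trans hm
  obtain rfl : d = 2 * m + 1 := by omega
  exact ⟨WeilSum.modEq_one_iff_three_dvd hp3 (Fact.out : p.Prime).one_lt hm,
    WeilSum.gcd_eq_one_iff_mod_nine m,
    fun _ => WeilSum.V_eq_div_three hp3 F hq.symm (hq.symm.trans hn)⟩
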